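/- Let $G$ be a finite non-abelian group with centre $Z(G)$ such that $G/Z(G)$ is abelian of order $p^3$, where $p$ is a prime, and put $x=|Z(G)|$. Let $\mathcal{CCC}(G)$ be the commuting conjugacy class graph of $G$: its vertices are the conjugacy classes of the non-central elements of $G$, and two distinct classes are adjacent if and only if some element of one commutes with some element of the other. Then $$m=\frac{x(p^2-1)}{p}\quad\text{and}\quad n=\frac{x(p-1)}{p^2}$$ are integers, and $\mathcal{CCC}(G)$ is isomorphic to $K_m\sqcup p^2K_n$ or to $(p^2+p+1)K_n$, where $K_r$ is the complete graph on $r$ vertices and $lK_r$ is the disjoint union of $l$ copies of it. In both cases $\mathcal{CCC}(G)$ has at least one vertex and at least one edge and satisfies the Hansen–Vukičević inequality $$\frac{M_2(\Gamma)}{|e(\Gamma)|}\ \ge\ \frac{M_1(\Gamma)}{|v(\Gamma)|}\qquad\text{for }\Gamma=\mathcal{CCC}(G),$$ where $v(\Gamma)$ and $e(\Gamma)$ are the vertex set and the edge set of $\Gamma$, and $M_1(\Gamma)=\sum_{u\in v(\Gamma)}\deg(u)^2$ and $M_2(\Gamma)=\sum_{uw\in e(\Gamma)}\deg(u)\deg(w)$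 are the first and second Zagreb indices. -/

import Mathlib

/-- A vertex of the commuting conjugacy class graph of `G`: the conjugacy class of a non-central
element of `G`. -/
def CCCVertex (G : Type*) [Group G] : Type _ :=
  {c : ConjClasses G // ∃ g : G, g ∉ Subgroup.center G ∧ ConjClasses.mk g = c}

/-- The commuting conjugacy class graph of `G`: two distinct vertices (conjugacy classes of
non-central elements) are adjacent iff they have commuting representatives. -/
def CCC (G : Type*) [Group G] : SimpleGraph (CCCVertex G) where
  Adj c d := c ≠ d ∧ ∃ x y : G, ConjClasses.mk x = c.1 ∧ ConjClasses.mk y = d.1 ∧ x * y = y * x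
  symm := ⟨fun _ _ h => by
    obtain ⟨hne, x, y, hx, hy, hxy⟩ := h
    exact ⟨hne.symm, y, x, hy, hx, hxy.symm⟩⟩
  loopless := ⟨fun _ h => h.1 rfl⟩

noncomputable instance CCCVertex.instFintype (G : Type*) [Group G] [Finite G] :
    Fintype (CCCVertex G) :=
  haveI : Finite (ConjClasses G) := Quotient.finite _
  haveI : Finite (CCCVertex G) := Subtype.finite
  Fintype.ofFinite _

/-- The disjoint union `l Γ` of `l` copies of the graph `Γ`. -/
def disjointCopies {V : Type*} (l : ℕ) (Γ : SimpleGraph V) : SimpleGraph (Fin l × V) where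
  Adj a b := a.1 = b.1 ∧ Γ.Adj a.2 b.2
  symm := ⟨fun _ _ h => ⟨h.1.symm, h.2.symm⟩⟩
  loopless := ⟨fun _ h => Γ.irrefl h.2⟩

open Classical in
/-- The number of edges of a finite graph. -/
noncomputable def edgeCount {V : Type*} [Fintype V] (Γ : SimpleGraph V) : ℕ :=
  Γ.edgeFinset.card

open Classical in
/-- The first Zagreb index: the sum of `deg(v) ^ 2` over the vertices `v`. -/
noncomputable def firstZagreb {V : Type*} [Fintype V] (Γ : SimpleGraph V) : ℕ :=
  ∑ v : V, Γ.degree v ^ 2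

open Classical in
/-- The second Zagreb index: the sum of `deg(u) * deg(v)` over the (unordered) edges `uv`. -/
noncomputable def secondZagreb {V : Type*} [Fintype V] (Γ : SimpleGraph V) : ℕ :=
  ∑ e ∈ Γ.edgeFinset,
    Sym2.lift ⟨fun u v => Γ.degree u * Γ.degree v, fun _ _ => Nat.mul_comm _ _⟩ e

/-- The Hansen–Vukičević inequality `M₂(Γ) / |e(Γ)| ≥ M₁(Γ) / |v(Γ)|`, including the requirement
that both denominators are nonzero. -/
def HansenVukicevic {V : Type*} [Fintype V] (Γ : SimpleGraph V) : Prop :=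
  0 < Fintype.card V ∧ 0 < edgeCount Γ ∧
    (secondZagreb Γ : ℚ) / (edgeCount Γ : ℚ) ≥ (firstZagreb Γ : ℚ) / (Fintype.card V : ℚ)

/-!
Write `Z` for the centre and `C(g)` for the centralizer of `g`. Because `Z` has index `p ^ 3`, a
chain-of-subgroups argument (`mul_comm_of_mem_centralizer`) shows that `C(g)` is abelian for every
non-central `g`. Hence commuting is an equivalence relation on the non-central elements, and two of
them commute exactly when their centralizers agree. As `G ⧸ Z` is abelian, conjugate elements have
the same centralizer. So `CCC G` is a disjoint union of complete graphs, one for each subgroup `X`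
that is the centralizer of a non-central element (`CCC_adj_iff`). The component of `X` consists of
the classes contained in `X \ Z`, all of size `[G : X]`, and `[G : X]` is `p` or `p ^ 2`; this gives
components of size `m` and `n` respectively (`card_vertex_mul_index`). Two centralizers of index `p`
would meet in `Z`, which is impossible by index (`centralizer_eq_of_index_eq`), so at most one has
index `p`. The sets `X \ Z` partition `G \ Z`, which determines the number of components in either
case.

In a disjoint union of complete graphs adjacent vertices have equal degrees. The numbers `M₁`, `M₂`
and `|e|` are then, up to factors `2`, the power sums of the degrees with exponents `2`, `3` and `1`,
and the Hansen–Vukičević inequality is Chebyshev's sum inequality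
(`hansenVukicevic_of_degree_eq`). The graph has an edge because `m ≥ 2`, and because `n = 1` would
force `p = 2` and `|Z| = 4`: then not all centralizers of non-central elements can have index `4`
(`exists_index_centralizer_ne_four`), so the component `K_m` is present.
-/

/-! ### Disjoint unions of complete graphs -/

/-- If adjacency in `Γ` means being distinct with equal value of `f`, and `f` has `l` fibres, all
of size `n`, then `Γ` is the disjoint union of `l` copies of `K_n`. -/
theorem nonempty_iso_disjointCopies {V ι : Type*} [Finite V] [Finite ι] {Γ : SimpleGraph V}
    (f : V → ι) (hadj : ∀ u v, Γ.Adj u v ↔ u ≠ v ∧ f u = f v) {l n : ℕ}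
    (hι : Nat.card ι = l) (hf : ∀ i, Nat.card {v // f v = i} = n) :
    Nonempty (Γ ≃g disjointCopies l (⊤ : SimpleGraph (Fin n))) := by
  subst hι
  let e : ι ≃ Fin (Nat.card ι) := Finite.equivFin ι
  let F (i : ι) : {v // f v = i} ≃ Fin n := Finite.equivFinOfCardEq (hf i)
  let E : V ≃ Fin (Nat.card ι) × Fin n :=
    ((Equiv.sigmaFiberEquiv f).symm.trans (Equiv.sigmaCongrRight F)).trans
      ((Equiv.sigmaEquivProd ι (Fin n)).trans (e.prodCongr (Equiv.refl _)))
  have h1 (v : V) : (E v).1 = e (f v) := rfl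
  refine ⟨⟨E, fun {u v} => ?_⟩⟩
  rw [hadj]
  change (E u).1 = (E v).1 ∧ (E u).2 ≠ (E v).2 ↔ _
  have h3 : (E u).1 = (E v).1 ↔ f u = f v := by rw [h1, h1, e.apply_eq_iff_eq]
  have h4 : u = v ↔ (E u).1 = (E v).1 ∧ (E u).2 = (E v).2 := by
    rw [← E.apply_eq_iff_eq, Prod.ext_iff]
  rw [← h3]
  tauto

/-- If adjacency in `Γ` means being distinct with equal value of `f`, and `f` has one fibre of
size `m` and `l` further fibres of size `n`, then `Γ` is `K_m ⊔ l K_n`. -/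
theorem nonempty_iso_sum_disjointCopies {V ι : Type*} [Finite V] [Finite ι] {Γ : SimpleGraph V}
    (f : V → ι) (hadj : ∀ u v, Γ.Adj u v ↔ u ≠ v ∧ f u = f v) {l m n : ℕ} (i₀ : ι)
    (hι : Nat.card ι = l + 1) (hm : Nat.card {v // f v = i₀} = m)
    (hf : ∀ i, i ≠ i₀ → Nat.card {v // f v = i} = n) :
    Nonempty (Γ ≃g (⊤ : SimpleGraph (Fin m)) ⊕g
      disjointCopies l (⊤ : SimpleGraph (Fin n))) := by
  classical
  let f' : {v // ¬ f v = i₀} → {i // i ≠ i₀} := fun v => ⟨f v, v.2⟩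
  have hι' : Nat.card {i // i ≠ i₀} = l := by
    have h := Nat.card_congr (Equiv.sumCompl fun i => i = i₀)
    rw [Nat.card_sum, Nat.card_unique, hι] at h
    change Nat.card {i // ¬ i = i₀} = l
    omega
  obtain ⟨φ⟩ := nonempty_iso_disjointCopies (Γ := Γ.comap (Subtype.val : {v // ¬ f v = i₀} → V))
    f' (fun u v => by
      rw [SimpleGraph.comap_adj, hadj, Ne, Ne, Subtype.ext_iff, Subtype.ext_iff]) hι'
    (n := n) (fun i => by
      rw [← hf i.1 i.2]
      refine Nat.card_congr ⟨fun v => ⟨v.1.1, congrArg Subtype.val v.2⟩,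
        fun v => ⟨⟨v.1, fun h => i.2 (v.2.symm.trans h)⟩, Subtype.ext v.2⟩,
        fun _ => rfl, fun _ => rfl⟩)
  let ψ : {v // f v = i₀} ≃ Fin m := Finite.equivFinOfCardEq hm
  let E := (Equiv.sumCongr ψ φ.toEquiv).symm.trans (Equiv.sumCompl fun v => f v = i₀)
  refine ⟨SimpleGraph.Iso.symm ⟨E, ?_⟩⟩
  intro a b
  obtain ⟨a, rfl⟩ := (Equiv.sumCongr ψ φ.toEquiv).surjective a
  obtain ⟨b, rfl⟩ := (Equiv.sumCongr ψ φ.toEquiv).surjective b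
  simp only [E, Equiv.trans_apply, Equiv.symm_apply_apply]
  rcases a with a | a <;> rcases b with b | b
  · simp [hadj, a.2, b.2, Subtype.ext_iff]
  · simp [hadj, a.2, Ne.symm b.2]
  · simp [hadj, a.2, b.2]
  · simpa using (φ.map_adj_iff (v := a) (w := b)).symm

/-! ### Zagreb indices -/

open Finset in
/-- Each edge is the edge of two darts, so if adjacent vertices have equal degrees then twice a sum
of squared degrees over the edges is a sum of cubed degrees over the vertices. -/
theorem two_mul_secondZagreb {V : Type*} [Fintype V] (Γ : SimpleGraph V) [DecidableRel Γ.Adj]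
    (h : ∀ u v, Γ.Adj u v → Γ.degree u = Γ.degree v) :
    2 * secondZagreb Γ = ∑ v, Γ.degree v * Γ.degree v ^ 2 := by
  classical
  let F : Sym2 V → ℕ :=
    Sym2.lift ⟨fun u v => Γ.degree u * Γ.degree v, fun _ _ => Nat.mul_comm _ _⟩
  have h2 : secondZagreb Γ = ∑ e ∈ Γ.edgeFinset, F e := by
    unfold secondZagreb
    convert! rfl
  have hF (d : Γ.Dart) : F d.edge = Γ.degree d.fst ^ 2 := by
    change Γ.degree d.fst * Γ.degree d.snd = _
    rw [← h _ _ d.adj, sq]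
  calc 2 * secondZagreb Γ = ∑ e ∈ Γ.edgeFinset, ∑ d : Γ.Dart with d.edge = e, F d.edge := by
        rw [h2, mul_sum]
        refine sum_congr rfl fun e he => ?_
        rw [sum_congr rfl (g := fun _ => F e) fun d hd => by rw [(mem_filter.1 hd).2],
          sum_const, Γ.dart_edge_fiber_card e (SimpleGraph.mem_edgeFinset.1 he), smul_eq_mul]
    _ = ∑ d : Γ.Dart, F d.edge :=
        sum_fiberwise_of_maps_to (fun d _ => SimpleGraph.mem_edgeFinset.2 d.edge_mem) _
    _ = ∑ v, ∑ d : Γ.Dart with d.fst = v, F d.edge := (sum_fiberwise _ _ _).symm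
    _ = _ := by
        refine sum_congr rfl fun v _ => ?_
        rw [sum_congr rfl (g := fun _ => Γ.degree v ^ 2) fun d hd => by
          rw [hF, (mem_filter.1 hd).2], sum_const, Γ.dart_fst_fiber_card_eq_degree, smul_eq_mul]

/-- A graph with an edge in which adjacent vertices have equal degrees satisfies the
Hansen–Vukičević inequality: it becomes Chebyshev's sum inequality for `deg` and `deg²`. -/
theorem hansenVukicevic_of_degree_eq {V : Type*} [Fintype V] (Γ : SimpleGraph V)
    [DecidableRel Γ.Adj] (h : ∀ u v, Γ.Adj u v → Γ.degree u = Γ.degree v) {a b : V}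
    (hab : Γ.Adj a b) : HansenVukicevic Γ := by
  classical
  have he : edgeCount Γ = Γ.edgeFinset.card := by
    unfold edgeCount
    convert! rfl
  have h1 : firstZagreb Γ = ∑ v, Γ.degree v ^ 2 := by
    unfold firstZagreb
    convert! rfl
  have hV : 0 < Fintype.card V := Fintype.card_pos_iff.2 ⟨a⟩
  have hE : 0 < edgeCount Γ := by
    rw [he, Finset.card_pos]
    exact ⟨s(a, b), SimpleGraph.mem_edgeFinset.2 hab⟩
  refine ⟨hV, hE, ?_⟩
  have hc : (∑ v, (Γ.degree v : ℚ)) * ∑ v, (Γ.degree v : ℚ) ^ 2 ≤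
      Fintype.card V * ∑ v, (Γ.degree v : ℚ) * (Γ.degree v : ℚ) ^ 2 := by
    refine Monovary.sum_mul_sum_le_card_mul_sum fun u v huv => ?_
    exact (lt_of_pow_lt_pow_left₀ 2 (Nat.cast_nonneg _) huv).le
  have h2 := congrArg (Nat.cast : ℕ → ℚ) (two_mul_secondZagreb Γ h)
  have h3 := congrArg (Nat.cast : ℕ → ℚ) Γ.sum_degrees_eq_twice_card_edges
  rw [← he] at h3
  have h1' := congrArg (Nat.cast : ℕ → ℚ) h1
  push_cast at h1' h2 h3
  rw [← h1', ← h2, h3] at hc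
  rw [ge_iff_le, div_le_div_iff₀ (by exact_mod_cast hV) (by exact_mod_cast hE)]
  linarith

/-- In a disjoint union of complete graphs adjacent vertices have equal degrees. -/
theorem degree_eq_of_adj_of_fiber {V ι : Type*} [Fintype V] {Γ : SimpleGraph V}
    [DecidableRel Γ.Adj] (f : V → ι) (hadj : ∀ u v, Γ.Adj u v ↔ u ≠ v ∧ f u = f v) {u v : V}
    (h : Γ.Adj u v) : Γ.degree u = Γ.degree v := by
  classical
  have key (w : V) : Γ.degree w + 1 = (Finset.univ.filter fun z => f z = f w).card := by
    rw [← SimpleGraph.card_neighborFinset_eq_degree,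
      ← Finset.card_insert_of_notMem (Γ.notMem_neighborFinset_self w)]
    congr 1
    ext z
    simp only [Finset.mem_insert, SimpleGraph.mem_neighborFinset, hadj, Finset.mem_filter,
      Finset.mem_univ, true_and]
    by_cases hz : z = w
    · simp [hz]
    · simp [hz, Ne.symm hz, eq_comm]
  have hu := key u
  have hv := key v
  rw [((hadj u v).1 h).2] at hu
  omega

/-! ### Centralizers of non-central elements -/

open Subgroup in
theorem centralizer_singleton_eq_top_iff {G : Type*} [Group G] {g : G} :
    centralizer {g} = ⊤ ↔ g ∈ center G := by
  rw [centralizer_eq_top_iff_subset, Set.singleton_subset_iff, SetLike.mem_coe]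

open Subgroup in
/-- When the centre has index `p ^ 3`, the centralizer of a non-central element `g` is abelian.
If `a, b` in it did not commute, then the centralizers of `{g, a, b}`, `{g, a}`, `{g}` and `∅` would
form a strictly increasing chain strictly above the centre, which needs index at least `p ^ 4`. -/
theorem mul_comm_of_mem_centralizer {G : Type*} [Group G] [Finite G] {p : ℕ} (hp : p.Prime)
    (hZ : (center G).index = p ^ 3) {g a b : G} (hg : g ∉ center G)
    (ha : a ∈ centralizer {g}) (hb : b ∈ centralizer {g}) : a * b = b * a := by
  by_contra hab
  have hdvd {H : Subgroup G} (hH : center G ≤ H) : ∃ j ≤ 3, H.index = p ^ j :=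
    (Nat.dvd_prime_pow hp).1 (hZ ▸ index_dvd_of_le hH)
  have hle (c : G) : center G ≤ centralizer {c} := center_le_centralizer _
  have hcomm {c d : G} (h : c ∈ centralizer {d}) : d ∈ centralizer {c} := by
    rw [mem_centralizer_singleton_iff] at h ⊢
    exact h.symm
  have hself (c : G) : c ∈ centralizer {c} := mem_centralizer_singleton_iff.2 rfl
  have hba : b ∉ centralizer {a} := fun h => hab (mem_centralizer_singleton_iff.1 h).symm
  have hA : center G < (centralizer {g} ⊓ centralizer {a}) ⊓ centralizer {b} :=
    lt_of_le_of_ne (le_inf (le_inf (hle g) (hle a)) (hle b)) fun h =>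
      hg (h ▸ ⟨⟨hself g, hcomm ha⟩, hcomm hb⟩)
  have hB : (centralizer {g} ⊓ centralizer {a}) ⊓ centralizer {b} <
      centralizer {g} ⊓ centralizer {a} :=
    lt_of_le_of_ne inf_le_left fun h =>
      hba (hcomm (inf_eq_left.1 h ⟨ha, hself a⟩))
  have hC : centralizer {g} ⊓ centralizer {a} < centralizer {g} :=
    lt_of_le_of_ne inf_le_left fun h => hba (inf_eq_left.1 h hb)
  obtain ⟨j, -, hj⟩ := hdvd hA.le
  obtain ⟨k, -, hk⟩ := hdvd (hA.trans hB).le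
  obtain ⟨l, -, hl⟩ := hdvd (hle g)
  have hl0 : l ≠ 0 := by
    rintro rfl
    exact hg (centralizer_singleton_eq_top_iff.1 (index_eq_one.1 (by simpa using hl)))
  have i1 := index_strictAnti hA
  have i2 := index_strictAnti hB
  have i3 := index_strictAnti hC
  rw [hZ, hj, Nat.pow_lt_pow_iff_right hp.one_lt] at i1
  rw [hj, hk, Nat.pow_lt_pow_iff_right hp.one_lt] at i2
  rw [hk, hl, Nat.pow_lt_pow_iff_right hp.one_lt] at i3
  omega

open Subgroup in
theorem index_centralizer_eq_or {G : Type*} [Group G] [Finite G] {p : ℕ} (hp : p.Prime)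
    (hZ : (center G).index = p ^ 3) {g : G} (hg : g ∉ center G) :
    (centralizer {g}).index = p ∨ (centralizer {g}).index = p ^ 2 := by
  have hlt : center G < centralizer {g} := lt_of_le_of_ne (center_le_centralizer _) fun h =>
    hg (h ▸ mem_centralizer_singleton_iff.2 rfl)
  obtain ⟨j, -, hj⟩ := (Nat.dvd_prime_pow hp).1 (hZ ▸ index_dvd_of_le hlt.le)
  have hi := index_strictAnti hlt
  rw [hZ, hj, Nat.pow_lt_pow_iff_right hp.one_lt] at hi
  have hj0 : j ≠ 0 := by
    rintro rfl
    exact hg (centralizer_singleton_eq_top_iff.1 (index_eq_one.1 (by simpa using hj)))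
  obtain rfl | rfl : j = 1 ∨ j = 2 := by omega
  · exact .inl (by simpa using hj)
  · exact .inr hj

open Subgroup in
theorem centralizer_eq_of_mem {G : Type*} [Group G] [Finite G] {p : ℕ} (hp : p.Prime)
    (hZ : (center G).index = p ^ 3) {g a : G} (hg : g ∉ center G) (ha : a ∉ center G)
    (h : a ∈ centralizer {g}) : centralizer {a} = centralizer {g} := by
  have h' : g ∈ centralizer {a} :=
    mem_centralizer_singleton_iff.2 (mem_centralizer_singleton_iff.1 h).symm
  ext b
  exact ⟨fun hb => mem_centralizer_singleton_iff.2 (mul_comm_of_mem_centralizer hp hZ ha hb h'),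
    fun hb => mem_centralizer_singleton_iff.2 (mul_comm_of_mem_centralizer hp hZ hg hb h)⟩

open Subgroup in
theorem mem_centralizer_iff_centralizer_eq {G : Type*} [Group G] [Finite G] {p : ℕ}
    (hp : p.Prime) (hZ : (center G).index = p ^ 3) {g a : G} (hg : g ∉ center G) :
    a ∈ centralizer {g} ∧ a ∉ center G ↔ a ∉ center G ∧ centralizer {a} = centralizer {g} :=
  ⟨fun h => ⟨h.2, centralizer_eq_of_mem hp hZ hg h.2 h.1⟩,
    fun h => ⟨h.2 ▸ mem_centralizer_singleton_iff.2 rfl, h.1⟩⟩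

open Subgroup in
/-- At most one centralizer of a non-central element has index `p`: two different ones meet in the
centre, which then would have index at most `p ^ 2`. -/
theorem centralizer_eq_of_index_eq {G : Type*} [Group G] [Finite G] {p : ℕ} (hp : p.Prime)
    (hZ : (center G).index = p ^ 3) {g a : G} (hg : g ∉ center G) (ha : a ∉ center G)
    (hgp : (centralizer {g}).index = p) (hap : (centralizer {a}).index = p) :
    centralizer {a} = centralizer {g} := by
  by_contra hne
  have hle : centralizer {g} ⊓ centralizer {a} ≤ center G := by
    intro b hb
    by_contra hbZ
    exact hne ((centralizer_eq_of_mem hp hZ ha hbZ hb.2).symm.trans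
      (centralizer_eq_of_mem hp hZ hg hbZ hb.1))
  have h1 := (index_antitone hle).trans (index_inf_le (H := centralizer {g}))
  rw [hZ, hgp, hap, ← sq] at h1
  exact absurd ((Nat.pow_le_pow_iff_right hp.one_lt).1 h1) (by norm_num)

open Subgroup in
/-- Conjugates differ by a central factor, so they have the same centralizer. -/
theorem centralizer_eq_of_isConj {G : Type*} [Group G]
    (hab : ∀ a b : G ⧸ center G, a * b = b * a) {a b : G} (h : IsConj a b) :
    centralizer {a} = centralizer {b} := by
  obtain ⟨c, rfl⟩ := isConj_iff.1 h
  have hz : c * a * c⁻¹ * a⁻¹ ∈ center G := by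
    rw [← QuotientGroup.eq_one_iff]
    rw [QuotientGroup.mk_mul, QuotientGroup.mk_mul, QuotientGroup.mk_mul, hab c a,
      QuotientGroup.mk_inv, QuotientGroup.mk_inv]
    group
  obtain ⟨z, hz, hcz⟩ : ∃ z ∈ center G, c * a * c⁻¹ = z * a :=
    ⟨_, hz, by group⟩
  rw [hcz]
  ext d
  rw [mem_centralizer_singleton_iff, mem_centralizer_singleton_iff, mul_assoc z,
    ← mul_assoc d, mem_center_iff.1 hz d, mul_assoc z, mul_right_inj]

/-! ### The commuting conjugacy class graph -/

open Subgroup in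
/-- The centralizer of a chosen representative of a non-central class. When `G ⧸ Z(G)` is abelian
this does not depend on the representative. -/
noncomputable def CCCVertex.centralizer {G : Type*} [Group G] (c : CCCVertex G) : Subgroup G :=
  Subgroup.centralizer {c.2.choose}

open Subgroup in
theorem CCCVertex.centralizer_eq {G : Type*} [Group G]
    (hab : ∀ a b : G ⧸ center G, a * b = b * a) {c : CCCVertex G} {g : G}
    (h : ConjClasses.mk g = c.1) : c.centralizer = Subgroup.centralizer {g} :=
  centralizer_eq_of_isConj hab
    (ConjClasses.mk_eq_mk_iff_isConj.1 (c.2.choose_spec.2.trans h.symm))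

open Subgroup in
theorem CCCVertex.notMem_center {G : Type*} [Group G] {c : CCCVertex G} {g : G}
    (h : ConjClasses.mk g = c.1) : g ∉ center G := by
  intro hg
  obtain ⟨y, hy, hyc⟩ := c.2
  have h1 : IsConj g y := ConjClasses.mk_eq_mk_iff_isConj.1 (h.trans hyc.symm)
  obtain ⟨d, rfl⟩ := isConj_iff.1 h1
  exact hy ((inferInstance : (center G).Normal).conj_mem g hg d)

/-- The class of a non-central element, as a vertex. -/
def CCCVertex.mk {G : Type*} [Group G] (g : G) (hg : g ∉ Subgroup.center G) : CCCVertex G :=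
  ⟨ConjClasses.mk g, g, hg, rfl⟩

open Subgroup in
/-- Since commuting is transitive on non-central elements, adjacency amounts to equality of
centralizers. -/
theorem CCC_adj_iff {G : Type*} [Group G] [Finite G] {p : ℕ} (hp : p.Prime)
    (hab : ∀ a b : G ⧸ center G, a * b = b * a) (hZ : (center G).index = p ^ 3)
    (c d : CCCVertex G) : (CCC G).Adj c d ↔ c ≠ d ∧ c.centralizer = d.centralizer := by
  refine and_congr_right fun _ => ⟨?_, fun h => ?_⟩
  · rintro ⟨x, y, hx, hy, hxy⟩
    rw [CCCVertex.centralizer_eq hab hx, CCCVertex.centralizer_eq hab hy]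
    exact centralizer_eq_of_mem hp hZ (CCCVertex.notMem_center hy) (CCCVertex.notMem_center hx)
      (mem_centralizer_singleton_iff.2 hxy)
  · obtain ⟨x, -, hx⟩ := id c.2
    obtain ⟨y, -, hy⟩ := id d.2
    rw [CCCVertex.centralizer_eq hab hx, CCCVertex.centralizer_eq hab hy] at h
    exact ⟨x, y, hx, hy, mem_centralizer_singleton_iff.1
      (h ▸ mem_centralizer_singleton_iff.2 rfl : x ∈ Subgroup.centralizer {y})⟩

/-! ### Counting -/

theorem Nat.card_eq_sum_card_fiber {α β : Type*} [Finite α] [Fintype β] (f : α → β) :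
    Nat.card α = ∑ b, Nat.card {a // f a = b} := by
  rw [← Nat.card_sigma, Nat.card_congr (Equiv.sigmaFiberEquiv f)]

open Subgroup in
theorem card_conjClass_eq_index {G : Type*} [Group G] (g : G) :
    Nat.card {x : G // ConjClasses.mk x = ConjClasses.mk g} = (centralizer {g}).index := by
  have h : (centralizer {g}).index = (MulAction.stabilizer (ConjAct G) g).index := by
    rw [ConjAct.stabilizer_eq_centralizer]
    rfl
  rw [h, MulAction.index_stabilizer, ConjAct.orbit_eq_carrier_conjClasses,
    ← Nat.card_coe_set_eq]
  exact Nat.card_congr (Equiv.subtypeEquivRight fun x => ConjClasses.mem_carrier_iff_mk_eq.symm)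

open Subgroup in
theorem card_mem_diff_center {G : Type*} [Group G] [Finite G] {H : Subgroup G}
    (hH : center G ≤ H) :
    Nat.card {x : G // x ∈ H ∧ x ∉ center G} + Nat.card (center G) = Nat.card H :=
  Set.ncard_sdiff_add_ncard_of_subset (s := (center G : Set G)) (t := H) hH

open Subgroup in
/-- The elements of `C(g) \ Z(G)` are distributed over the vertices with centralizer `C(g)`, each of
which is a class of size `[G : C(g)]`. -/
theorem card_vertex_mul_index {G : Type*} [Group G] [Finite G] {p : ℕ} (hp : p.Prime)
    (hab : ∀ a b : G ⧸ center G, a * b = b * a) (hZ : (center G).index = p ^ 3)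
    {g : G} (hg : g ∉ center G) :
    Nat.card {c : CCCVertex G // c.centralizer = centralizer {g}} * (centralizer {g}).index =
      Nat.card {x : G // x ∈ centralizer {g} ∧ x ∉ center G} := by
  classical
  let f : {x : G // x ∈ centralizer {g} ∧ x ∉ center G} →
      {c : CCCVertex G // c.centralizer = centralizer {g}} := fun x =>
    ⟨CCCVertex.mk x.1 x.2.2, (CCCVertex.centralizer_eq hab rfl).trans
      (centralizer_eq_of_mem hp hZ hg x.2.2 x.2.1)⟩
  rw [Nat.card_eq_sum_card_fiber f, Finset.sum_congr rfl (g := fun _ => (centralizer {g}).index),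
    Finset.sum_const, Finset.card_univ, Nat.card_eq_fintype_card, smul_eq_mul]
  intro c _
  obtain ⟨y, hy, hyc⟩ := id c.1.2
  have hyg : centralizer {y} = centralizer {g} :=
    (CCCVertex.centralizer_eq hab hyc).symm.trans c.2
  refine Eq.trans ?_ ((card_conjClass_eq_index y).trans (congrArg index hyg))
  rw [hyc]
  refine Nat.card_congr ⟨fun x => ⟨x.1.1, congrArg (fun c => c.1.1) x.2⟩,
    fun x => ⟨⟨x.1, ?_⟩, Subtype.ext (Subtype.ext x.2)⟩, fun _ => rfl, fun _ => rfl⟩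
  have hx := CCCVertex.notMem_center x.2
  have hxg : centralizer {x.1} = centralizer {g} :=
    (CCCVertex.centralizer_eq hab x.2).symm.trans c.2
  exact ⟨hxg.le (mem_centralizer_singleton_iff.2 rfl), hx⟩

open Subgroup in
/-- The sets `X \ Z(G)`, with `X` a centralizer of a non-central element, partition `G \ Z(G)`. -/
theorem sum_card_centralizer_diff_center {G : Type*} [Group G] [Finite G] {p : ℕ}
    (hp : p.Prime) (hab : ∀ a b : G ⧸ center G, a * b = b * a)
    (hZ : (center G).index = p ^ 3)
    [Fintype (Set.range (CCCVertex.centralizer (G := G)))] :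
    ∑ X : Set.range (CCCVertex.centralizer (G := G)),
      Nat.card {x : G // x ∈ X.1 ∧ x ∉ center G} + Nat.card (center G) = Nat.card G := by
  have h := card_mem_diff_center (le_top : center G ≤ ⊤)
  rw [card_top] at h
  rw [← h]
  congr 1
  let f : {x : G // x ∈ (⊤ : Subgroup G) ∧ x ∉ center G} →
      Set.range (CCCVertex.centralizer (G := G)) := fun x =>
    ⟨centralizer {x.1}, CCCVertex.mk x.1 x.2.2, CCCVertex.centralizer_eq hab rfl⟩
  rw [Nat.card_eq_sum_card_fiber f]
  refine Finset.sum_congr rfl fun X _ => ?_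
  obtain ⟨_, c, rfl⟩ := X
  obtain ⟨g, hg, hgc⟩ := id c.2
  have key (a : G) : a ∈ c.centralizer ∧ a ∉ center G ↔
      a ∉ center G ∧ centralizer {a} = c.centralizer := by
    rw [CCCVertex.centralizer_eq hab hgc]
    exact mem_centralizer_iff_centralizer_eq hp hZ hg
  exact Nat.card_congr ⟨fun x => ⟨⟨x.1, mem_top _, x.2.2⟩, Subtype.ext ((key x.1).1 x.2).2⟩,
    fun x => ⟨x.1.1, (key x.1.1).2 ⟨x.1.2.2, congrArg Subtype.val x.2⟩⟩,
    fun _ => rfl, fun _ => rfl⟩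

/-! ### Commutators in groups of class two -/

section

open scoped commutatorElement

open Subgroup in
theorem commutatorElement_mem_center {G : Type*} [Group G]
    (hab : ∀ a b : G ⧸ center G, a * b = b * a) (a b : G) : ⁅a, b⁆ ∈ center G := by
  rw [← QuotientGroup.eq_one_iff, commutatorElement_def, QuotientGroup.mk_mul,
    QuotientGroup.mk_mul, QuotientGroup.mk_mul, hab a b, QuotientGroup.mk_inv,
    QuotientGroup.mk_inv]
  group

open Subgroup in
theorem commutatorElement_mul_right_of_center {G : Type*} [Group G]
    (hab : ∀ a b : G ⧸ center G, a * b = b * a) (a b c : G) : ⁅a, b * c⁆ = ⁅a, b⁆ * ⁅a, c⁆ := by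
  have h1 : ⁅a, b * c⁆ = ⁅a, b⁆ * (b * ⁅a, c⁆ * b⁻¹) := by
    simp only [commutatorElement_def]
    group
  rw [h1, mem_center_iff.1 (commutatorElement_mem_center hab a c) b, mul_inv_cancel_right]

open Subgroup in
theorem commutatorElement_mul_left_of_center {G : Type*} [Group G]
    (hab : ∀ a b : G ⧸ center G, a * b = b * a) (a b c : G) : ⁅a * b, c⁆ = ⁅a, c⁆ * ⁅b, c⁆ := by
  rw [← commutatorElement_inv, commutatorElement_mul_right_of_center hab, mul_inv_rev,
    commutatorElement_inv, commutatorElement_inv,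
    mem_center_iff.1 (commutatorElement_mem_center hab a c)]

open Subgroup in
theorem commutatorElement_eq_one_of_mem_center {G : Type*} [Group G] {a : G} (ha : a ∈ center G)
    (b : G) : ⁅a, b⁆ = 1 :=
  commutatorElement_eq_one_iff_mul_comm.2 (mem_center_iff.1 ha b).symm

open Subgroup in
/-- A group with centre of order `4` and index `8` has a non-central element whose centralizer does
not have index `4`. Otherwise let `g, h, k` be a basis of `G ⧸ Z(G)` with `[g, h] ≠ 1`. Then
`1, [g, h], [g, k], [g, h] [g, k]` exhaust the centre, so `[h, k] = [g, h]^b [g, k]^a` for some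
exponents, and then `g^a h` and `k g^b` commute although they are independent in `G ⧸ Z(G)`. -/
theorem exists_index_centralizer_ne_four {G : Type*} [Group G] [Finite G]
    (hG : ¬ ∀ a b : G, a * b = b * a) (hab : ∀ a b : G ⧸ center G, a * b = b * a)
    (hZ : (center G).index = 8) (hcard : Nat.card (center G) = 4) :
    ∃ g ∉ center G, (centralizer {g}).index ≠ 4 := by
  classical
  by_contra! hall
  have key (a b : G) (h : ⁅a, b⁆ = 1) : a ∈ center G ∨ b ∈ center G ∨ a * b ∈ center G := by
    by_cases ha : a ∈ center G
    · exact .inl ha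
    by_cases hb : b ∈ center G
    · exact .inr (.inl hb)
    refine .inr (.inr ?_)
    have h1 := relIndex_mul_index (center_le_centralizer {a})
    rw [hZ, hall a ha] at h1
    have h2 : ((center G).subgroupOf (centralizer {a})).index = 2 := by
      change (center G).relIndex _ = 2
      omega
    have h3 := mul_mem_iff_of_index_two h2 (a := ⟨a, mem_centralizer_singleton_iff.2 rfl⟩)
      (b := ⟨b, mem_centralizer_singleton_iff.2 (commutatorElement_eq_one_iff_mul_comm.1 h).symm⟩)
    simp only [mem_subgroupOf, MulMemClass.mk_mul_mk] at h3
    exact h3.2 (by simp [ha, hb])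
  have hcomm {a b : G} (h : a * b ∈ center G) : b * a ∈ center G := by
    rw [← QuotientGroup.eq_one_iff, QuotientGroup.mk_mul] at h ⊢
    rwa [hab]
  have hL := commutatorElement_mul_left_of_center hab
  have hR := commutatorElement_mul_right_of_center hab
  have hone {a : G} (ha : a ∈ center G) (b : G) : ⁅a, b⁆ = 1 :=
    commutatorElement_eq_one_of_mem_center ha b
  have hsq (a : G) : a * a ∈ center G := by
    rcases key a a (commutatorElement_self a) with h | h | h
    · exact mul_mem h h
    · exact mul_mem h h
    · exact h
  have htwo (a b : G) : ⁅a, b⁆ * ⁅a, b⁆ = 1 := by rw [← hL, hone (hsq a)]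
  have hsymm (a b : G) : ⁅b, a⁆ = ⁅a, b⁆ := by
    rw [← commutatorElement_inv, inv_eq_iff_mul_eq_one, htwo]
  push Not at hG
  obtain ⟨g, h, hgh⟩ := hG
  rw [Ne, ← commutatorElement_eq_one_iff_mul_comm] at hgh
  have hg : g ∉ center G := fun hc => hgh (hone hc h)
  have hh : h ∉ center G := fun hc => hgh (hsymm g h ▸ hone hc g)
  have hgh' : g * h ∉ center G := fun hc => hgh (by
    have := hone hc h
    rwa [hL, commutatorElement_self, mul_one] at this)
  obtain ⟨k, hk, hgk, hhk, hghk⟩ : ∃ k : G, k ∉ center G ∧ g * k ∉ center G ∧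
      h * k ∉ center G ∧ g * h * k ∉ center G := by
    by_contra! hcon
    have : Fintype (G ⧸ center G) := Fintype.ofFinite _
    have hsub : (Finset.univ : Finset (G ⧸ center G)) ⊆
        {1, (g : G ⧸ center G)⁻¹, (h : G ⧸ center G)⁻¹, ((g * h : G) : G ⧸ center G)⁻¹} := by
      intro q _
      obtain ⟨k, rfl⟩ := QuotientGroup.mk_surjective q
      have hk := hcon k
      simp only [← QuotientGroup.eq_one_iff, QuotientGroup.mk_mul, mul_eq_one_iff_inv_eq] at hk
      simp only [Finset.mem_insert, Finset.mem_singleton, QuotientGroup.mk_mul]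
      grind
    have h1 := (Finset.card_le_card hsub).trans Finset.card_le_four
    rw [Finset.card_univ, ← Nat.card_eq_fintype_card] at h1
    change (center G).index ≤ 4 at h1
    omega
  have hz := htwo g h
  have hw := htwo g k
  have hv := htwo h k
  have hw1 : ⁅g, k⁆ ≠ 1 := fun hc => by
    rcases key _ _ hc with hc | hc | hc <;> contradiction
  have hv1 : ⁅h, k⁆ ≠ 1 := fun hc => by
    rcases key _ _ hc with hc | hc | hc <;> contradiction
  have hzw : ⁅g, h⁆ ≠ ⁅g, k⁆ := fun hc => by
    have h1 : ⁅g, h * k⁆ = 1 := by rw [hR, ← hc, hz]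
    rcases key _ _ h1 with hc | hc | hc
    · exact hg hc
    · exact hhk hc
    · exact hghk (by rwa [mul_assoc])
  have hvz : ⁅h, k⁆ ≠ ⁅g, h⁆ := fun hc => by
    have h1 : ⁅h, k * g⁆ = 1 := by rw [hR, hc, hsymm g h, hz]
    rcases key _ _ h1 with hc | hc | hc
    · exact hh hc
    · exact hgk (hcomm hc)
    · exact hghk (by rw [mul_assoc]; exact hcomm (by rwa [mul_assoc]))
  have hvw : ⁅h, k⁆ ≠ ⁅g, k⁆ := fun hc => by
    have h1 : ⁅g * h, k⁆ = 1 := by rw [hL, hc, hw]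
    rcases key _ _ h1 with hc | hc | hc <;> contradiction
  have hvzw : ⁅h, k⁆ ≠ ⁅g, h⁆ * ⁅g, k⁆ := fun hc => by
    have h1 : ⁅g * h, k * g⁆ = 1 := by
      rw [hL, hR, hR, commutatorElement_self, mul_one, hsymm g h, hc,
        mem_center_iff.1 (commutatorElement_mem_center hab g k) ⁅g, h⁆, mul_assoc ⁅g, k⁆, hz,
        mul_one, hw]
    rcases key _ _ h1 with hc | hc | hc
    · exact hgh' hc
    · exact hgk (hcomm hc)
    · refine hhk ?_
      have h2 : h * k * (g * g) ∈ center G := by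
        have := hcomm (a := g) (b := h * (k * g)) (by rwa [← mul_assoc])
        simpa only [mul_assoc] using this
      exact (mul_mem_cancel_right (hsq g)).1 h2
  have hzw1 : ⁅g, h⁆ * ⁅g, k⁆ ≠ 1 := fun hc => hzw (by
    rw [eq_inv_of_mul_eq_one_left hc, commutatorElement_inv, hsymm])
  have hfive : ({1, ⁅g, h⁆, ⁅g, k⁆, ⁅g, h⁆ * ⁅g, k⁆, ⁅h, k⁆} : Finset G).card = 5 := by
    rw [Finset.card_insert_of_notMem, Finset.card_insert_of_notMem, Finset.card_insert_of_notMem,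
      Finset.card_insert_of_notMem, Finset.card_singleton]
    · simpa using hvzw.symm
    · simpa using ⟨hgh, hvw.symm⟩
    · simpa using ⟨hzw, hw1, hvz.symm⟩
    · simpa using ⟨Ne.symm hgh, hw1.symm, hzw1.symm, hv1.symm⟩
  have hmem := commutatorElement_mem_center hab
  have hle : (({1, ⁅g, h⁆, ⁅g, k⁆, ⁅g, h⁆ * ⁅g, k⁆, ⁅h, k⁆} : Finset G) : Set G).ncard ≤
      (center G : Set G).ncard := by
    refine Set.ncard_le_ncard (fun x hx => ?_) (Set.toFinite _)
    simp only [Finset.coe_insert, Finset.coe_singleton, Set.mem_insert_iff,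
      Set.mem_singleton_iff] at hx
    rcases hx with rfl | rfl | rfl | rfl | rfl
    · exact one_mem _
    · exact hmem _ _
    · exact hmem _ _
    · exact mul_mem (hmem _ _) (hmem _ _)
    · exact hmem _ _
  rw [Set.ncard_coe_finset, hfive] at hle
  have h4 : (center G : Set G).ncard = 4 := hcard
  omega

end

/-! ### Structure of the graph -/

open Subgroup in
theorem card_mem_diff_center_of_index {G : Type*} [Group G] [Finite G] {p i j : ℕ} (hp : 0 < p)
    (hZ : (center G).index = p ^ (i + j)) {H : Subgroup G} (hH : center G ≤ H)
    (hi : H.index = p ^ i) :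
    Nat.card {x : G // x ∈ H ∧ x ∉ center G} + Nat.card (center G) =
      p ^ j * Nat.card (center G) := by
  rw [card_mem_diff_center hH]
  have h1 := card_mul_index H
  rw [← card_mul_index (center G), hZ, hi] at h1
  refine Nat.eq_of_mul_eq_mul_right (pow_pos hp i) (h1.trans ?_)
  ring

/-- If the fibre over a point has at least two elements, the graph has an edge, and so satisfies the
Hansen–Vukičević inequality. -/
theorem hansenVukicevic_of_fiber {V ι : Type*} [Fintype V] {Γ : SimpleGraph V}
    (f : V → ι) (hadj : ∀ u v, Γ.Adj u v ↔ u ≠ v ∧ f u = f v) {i : ι}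
    (hi : 1 < Nat.card {v // f v = i}) : HansenVukicevic Γ := by
  classical
  have : Nontrivial {v // f v = i} := Finite.one_lt_card_iff_nontrivial.1 hi
  obtain ⟨u, v, huv⟩ := exists_pair_ne {v // f v = i}
  exact hansenVukicevic_of_degree_eq Γ (fun _ _ => degree_eq_of_adj_of_fiber f hadj)
    ((hadj u v).2 ⟨fun h => huv (Subtype.ext h), u.2.trans v.2.symm⟩)

theorem mainTheorem4 (G : Type*) [Group G] [Finite G] (p : ℕ) (hp : p.Prime)
    (hG : ¬ ∀ a b : G, a * b = b * a)
    (hab : ∀ a b : G ⧸ Subgroup.center G, a * b = b * a)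
    (hcard : Nat.card (G ⧸ Subgroup.center G) = p ^ 3) :
    (∃ m n : ℕ,
      (m : ℚ) = (Nat.card (Subgroup.center G) : ℚ) * ((p : ℚ) ^ 2 - 1) / (p : ℚ) ∧
      (n : ℚ) = (Nat.card (Subgroup.center G) : ℚ) * ((p : ℚ) - 1) / (p : ℚ) ^ 2 ∧
      (Nonempty (CCC G ≃g
          ((⊤ : SimpleGraph (Fin m)) ⊕g
            disjointCopies (p ^ 2) (⊤ : SimpleGraph (Fin n)))) ∨
        Nonempty (CCC G ≃g
          disjointCopies (p ^ 2 + p + 1) (⊤ : SimpleGraph (Fin n))))) ∧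
    HansenVukicevic (CCC G) := by
  classical
  have hZ : (Subgroup.center G).index = p ^ 3 := hcard
  obtain ⟨x, hx⟩ : ∃ x, Nat.card (Subgroup.center G) = x := ⟨_, rfl⟩
  have hx0 : 0 < x := hx ▸ Nat.card_pos
  have hp0 : (p : ℚ) ≠ 0 := Nat.cast_ne_zero.2 hp.ne_zero
  obtain ⟨q, hq⟩ : ∃ q, p = q + 1 := ⟨p - 1, by have := hp.pos; omega⟩
  have hq0 : 0 < q := by have := hp.two_le; omega
  have hpq : (p : ℚ) - 1 = q := by rw [hq]; push_cast; ring
  let ι := Set.range (CCCVertex.centralizer (G := G))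
  let f : CCCVertex G → ι := Set.rangeFactorization _
  have : Fintype ι := Fintype.ofFinite _
  have hadj (c d : CCCVertex G) : (CCC G).Adj c d ↔ c ≠ d ∧ f c = f d := by
    rw [CCC_adj_iff hp hab hZ, Subtype.ext_iff]
    rfl
  have hfib (X : ι) : Nat.card {c // f c = X} * X.1.index =
      Nat.card {x : G // x ∈ X.1 ∧ x ∉ Subgroup.center G} := by
    obtain ⟨_, c, rfl⟩ := X
    obtain ⟨g, hg, hgc⟩ := id c.2
    have h := card_vertex_mul_index hp hab hZ hg
    rw [← CCCVertex.centralizer_eq hab hgc] at h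
    rw [← h]
    congr 1
    exact Nat.card_congr (Equiv.subtypeEquivRight fun d => Subtype.ext_iff)
  have hle (X : ι) : Subgroup.center G ≤ X.1 := by
    obtain ⟨_, c, rfl⟩ := X
    exact Subgroup.center_le_centralizer _
  have hor (X : ι) : X.1.index = p ∨ X.1.index = p ^ 2 := by
    obtain ⟨_, c, rfl⟩ := X
    exact index_centralizer_eq_or hp hZ c.2.choose_spec.1
  have huniq (X Y : ι) (hX : X.1.index = p) (hY : Y.1.index = p) : Y = X := by
    obtain ⟨_, c, rfl⟩ := X
    obtain ⟨_, d, rfl⟩ := Y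
    exact Subtype.ext (centralizer_eq_of_index_eq hp hZ c.2.choose_spec.1 d.2.choose_spec.1 hX hY)
  have hp1 (X : ι) (hX : X.1.index = p) :
      Nat.card {x : G // x ∈ X.1 ∧ x ∉ Subgroup.center G} + x = p ^ 2 * x := by
    rw [← hx]
    exact card_mem_diff_center_of_index (i := 1) (j := 2) hp.pos hZ (hle X) (by rw [hX, pow_one])
  have hp2 (X : ι) (hX : X.1.index = p ^ 2) :
      Nat.card {x : G // x ∈ X.1 ∧ x ∉ Subgroup.center G} = q * x := by
    have h := card_mem_diff_center_of_index (i := 2) (j := 1) hp.pos hZ (hle X) hX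
    rw [hx, pow_one] at h
    have h' : p * x = q * x + x := by rw [hq]; ring
    omega
  have hsum : ∑ X : ι, Nat.card {x : G // x ∈ X.1 ∧ x ∉ Subgroup.center G} + x = p ^ 3 * x := by
    have h := sum_card_centralizer_diff_center hp hab hZ
    rw [← Subgroup.card_mul_index (Subgroup.center G), hZ, hx] at h
    linarith
  -- A centralizer of index `p ^ 2` forces `p ^ 2 ∣ |Z(G)|`, because `p - 1` is prime to `p`.
  have hdvd (X : ι) (hX : X.1.index = p ^ 2) : p ^ 2 ∣ x := by
    have h1 : p ^ 2 ∣ q * x := ⟨_, by rw [← hp2 X hX, ← hfib X, hX, mul_comm]⟩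
    refine (Nat.Coprime.pow_left 2 ?_).dvd_of_dvd_mul_left h1
    rw [hq]
    simp
  -- Writing `|Z(G)| = p ^ 2 * y` and `q = p - 1`, the two clique sizes are `n = q * y` and
  -- `m = p * (q * (p + 1) * y)`.
  have hfib2 {y : ℕ} (hy : x = p ^ 2 * y) (X : ι) (hX : X.1.index = p ^ 2) :
      Nat.card {c // f c = X} = q * y := by
    have h := hfib X
    rw [hp2 X hX, hX, hy] at h
    exact Nat.eq_of_mul_eq_mul_right (pow_pos hp.pos 2) (h.trans (by ring))
  by_cases hex : ∃ X₀ : ι, X₀.1.index = p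
  · obtain ⟨X₀, hX₀⟩ := hex
    have hne (X : ι) (hX : X ≠ X₀) : X.1.index = p ^ 2 :=
      (hor X).resolve_left fun h => hX (huniq X₀ X hX₀ h)
    have hcardι : Nat.card ι = p ^ 2 + 1 := by
      rw [← Finset.add_sum_erase _ _ (Finset.mem_univ X₀),
        Finset.sum_congr rfl (g := fun _ => q * x)
          fun X hX => hp2 X (hne X (Finset.ne_of_mem_erase hX)),
        Finset.sum_const, Finset.card_erase_of_mem (Finset.mem_univ _), Finset.card_univ,
        smul_eq_mul, ← Nat.card_eq_fintype_card] at hsum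
      have h1 : 0 < Nat.card ι := Nat.card_pos_iff.2 ⟨⟨X₀⟩, inferInstance⟩
      have h2 := hp1 X₀ hX₀
      have h3 : (Nat.card ι - 1) * (q * x) = p ^ 2 * (q * x) := by
        have : p ^ 3 * x = p ^ 2 * (q * x) + p ^ 2 * x := by rw [hq]; ring
        omega
      have := Nat.eq_of_mul_eq_mul_right (Nat.mul_pos hq0 hx0) h3
      omega
    obtain ⟨X₁, hX₁⟩ : ∃ X₁ : ι, X₁ ≠ X₀ := by
      have : Nontrivial ι := Finite.one_lt_card_iff_nontrivial.1 (by
        rw [hcardι]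
        exact Nat.succ_lt_succ (pow_pos hp.pos 2))
      exact exists_ne X₀
    obtain ⟨y, hy⟩ := hdvd X₁ (hne X₁ hX₁)
    have hy0 : 0 < y := Nat.pos_of_ne_zero (by rintro rfl; omega)
    have hm : Nat.card {c // f c = X₀} = p * (q * (p + 1) * y) := by
      have h1 := hp1 X₀ hX₀
      rw [← hfib X₀, hX₀, hy] at h1
      refine Nat.eq_of_mul_eq_mul_right hp.pos (Nat.add_right_cancel (h1.trans ?_))
      rw [hq]
      ring
    refine ⟨⟨p * (q * (p + 1) * y), q * y, ?_, ?_, .inl ?_⟩, ?_⟩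
    · rw [hx, hy]
      push_cast
      rw [← hpq]
      field_simp
      ring
    · rw [hx, hy]
      push_cast
      rw [← hpq]
      field_simp
    · exact nonempty_iso_sum_disjointCopies f hadj X₀ hcardι hm
        fun X hX => hfib2 hy X (hne X hX)
    · refine hansenVukicevic_of_fiber f hadj (i := X₀) ?_
      rw [hm]
      exact hp.one_lt.trans_le (Nat.le_mul_of_pos_right p (by positivity))
  · push Not at hex
    have hne (X : ι) : X.1.index = p ^ 2 := (hor X).resolve_left (hex X)
    have hcardι : Nat.card ι = p ^ 2 + p + 1 := by
      rw [Finset.sum_congr rfl (g := fun _ => q * x) fun X _ => hp2 X (hne X), Finset.sum_const,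
        Finset.card_univ, smul_eq_mul, ← Nat.card_eq_fintype_card] at hsum
      have h3 : Nat.card ι * (q * x) = (p ^ 2 + p + 1) * (q * x) := by
        have : p ^ 3 * x = (p ^ 2 + p + 1) * (q * x) + x := by rw [hq]; ring
        omega
      exact Nat.eq_of_mul_eq_mul_right (Nat.mul_pos hq0 hx0) h3
    obtain ⟨X₁⟩ : Nonempty ι := (Nat.card_pos_iff.1 (by rw [hcardι]; exact Nat.succ_pos _)).1
    obtain ⟨y, hy⟩ := hdvd X₁ (hne X₁)
    have hy0 : 0 < y := Nat.pos_of_ne_zero (by rintro rfl; omega)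
    refine ⟨⟨p * (q * (p + 1) * y), q * y, ?_, ?_, .inr ?_⟩, ?_⟩
    · rw [hx, hy]
      push_cast
      rw [← hpq]
      field_simp
      ring
    · rw [hx, hy]
      push_cast
      rw [← hpq]
      field_simp
    · exact nonempty_iso_disjointCopies f hadj hcardι fun X => hfib2 hy X (hne X)
    · refine hansenVukicevic_of_fiber f hadj (i := X₁) ?_
      rw [hfib2 hy X₁ (hne X₁)]
      -- The copies of `K_n` have edges unless `n = 1`, that is, `p = 2` and `|Z(G)| = 4`.
      by_contra hlt
      have h1 : q * y = 1 := le_antisymm (not_lt.1 hlt) (Nat.mul_pos hq0 hy0)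
      obtain ⟨rfl, rfl⟩ := mul_eq_one.1 h1
      subst hq
      obtain ⟨g, hg, hg4⟩ := exists_index_centralizer_ne_four hG hab hZ (hx.trans hy)
      have h2 : (CCCVertex.mk g hg).centralizer.index = _ := hne ⟨_, CCCVertex.mk g hg, rfl⟩
      rw [CCCVertex.centralizer_eq hab (g := g) rfl] at h2
      exact hg4 h2
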